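/- Let $d\ge 1$, $n\ge 1$, let $\mathcal P_d$ be the set of probability vectors on $[d]=\{1,\dots,d\}$, and let $p_0\in\mathcal P_d$, $\gamma\in(0,1)$, $\alpha\in(0,1]$. A sequentially interactive mechanism $Q$ produces, from i.i.d. data $X_1,\dots,X_n\sim p$, private variables $Z_1,\dots,Z_n$ with values in a measurable space $\mathcal Z$, where $Z_i$ has conditional distribution $Q_i(\cdot\mid X_i,Z_1,\dots,Z_{i-1})$; it is $\alpha$-LDP if $Q_i(A\mid x,z_1,\dots,z_{i-1})\le e^{\alpha}Q_i(A\mid x',z_1,\dots,z_{i-1})$ for all $i$, all $x,x'\in[d]$, all $z_1,\dots,z_{i-1}\in\mathcal Z$ and all measurable $A\subseteq\mathcal Z$. For $r\in\{1,2\}$ let $$\mathcal R_{n,\alpha}(p_0,\delta,\mathbb L_r)=\inf_{Q}\ \inf_{\phi}\ \sup_{p\in\mathcal P_d:\ \|p-p_0\|_r\ge\delta}\bigl\{\mathbb E_{p_0}\phi(Z_1,\dots,Z_n)+\mathbb E_p\bigl(1-\phi(Z_1,\dots,Z_n)\bigr)\bigr\},$$ where $Q$ ranges over all $\alpha$-LDP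 sequentially interactive mechanisms and $\phi$ over all measurable maps $\mathcal Z^n\to[0,1]$ (a supremum over the empty set being $0$), and let $$\mathcal E_{n,\alpha}(p_0,\mathbb L_r)=\inf\{\delta>0:\mathcal R_{n,\alpha}(p_0,\delta,\mathbb L_r)\le\gamma\}.$$ There is a universal constant $C$ such that, for all such $d,n,p_0,\gamma,\alpha$ and every nonempty $B\subseteq[d]$, with $p_0(B^c)=\sum_{j\notin B}p_0(j)$, $$\mathcal E_{n,\alpha}(p_0,\mathbb L_1)\le C\max\Bigl\{\frac{|B|^{1/2}}{(n\alpha^2\gamma^2)^{1/2}},\,p_0(B^c)\Bigr\}\qquad\text{and}\qquad \mathcal E_{n,\alpha}(p_0,\mathbb L_2)\le\frac{C}{(n\alpha^2\gamma^2)^{1/2}}.$$ In particular, let $$\tilde j=\min\Bigl\{j\in\{1,\dots,d\}:\frac{j^{1/2}}{(n\alpha^2)^{1/2}}\ge\sum_{j'=j+1}^d p_0(j')\Bigr\}.$$ Then for every $\gamma\in(0,1)$ there is a constant $C_1=C_1(\gamma)$ such that, for all $d,n,p_0$ and all $\alpha\in(0,1]$, $$\mathcal E_{n,\alpha}(p_0,\mathbb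 L_1)\le C_1\,\frac{\tilde j^{1/2}}{(n\alpha^2)^{1/2}}.$$ -/

import Mathlib

open MeasureTheory ProbabilityTheory
open scoped ENNReal

noncomputable section

namespace LDPTesting

/-- The law of a random variable `X` on `[d]` with `ℙ(X = j) = p j`
(`[d]` is modelled by `Fin d`, so the letter `j` of `{1, …, d}` is `j - 1 : Fin d`). -/
def dataLaw {d : ℕ} (p : Fin d → ℝ) : Measure (Fin d) :=
  ∑ j, ENNReal.ofReal (p j) • Measure.dirac j

theorem isProbabilityMeasure_dataLaw {d : ℕ} {p : Fin d → ℝ} (hp : p ∈ stdSimplex ℝ (Fin d)) :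
    IsProbabilityMeasure (dataLaw p) := by
  constructor
  simp only [dataLaw, Measure.coe_finsetSum, Measure.coe_smul, Finset.sum_apply, Pi.smul_apply,
    measure_univ, smul_eq_mul, mul_one]
  rw [← ENNReal.ofReal_sum_of_nonneg (fun j _ => hp.1 j), hp.2, ENNReal.ofReal_one]

/-- A sequentially interactive privacy mechanism for `n` individuals with data in `[d]`:
`kernel i (x, z)` is the conditional distribution of the `i`-th private variable given that the
`i`-th individual has the value `x` and that the previous private variables are
`z = (z_0, …, z_{i-1})`. The output space `Z` is an arbitrary measurable space. -/
structure Mechanism (d n : ℕ) where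
  /-- the space of private outputs -/
  Z : Type
  /-- its σ-algebra -/
  mZ : MeasurableSpace Z
  /-- the conditional distributions of the private outputs -/
  kernel : (i : Fin n) → Kernel (Fin d × (Fin (i : ℕ) → Z)) Z
  /-- they are probability measures -/
  markov : ∀ i, IsMarkovKernel (kernel i)

attribute [instance] Mechanism.mZ Mechanism.markov

namespace Mechanism

variable {d n : ℕ}

/-- The `α`-local differential privacy constraint
`Q_i(A | x, z) ≤ e^α Q_i(A | x', z)` for all `i`, `A`, `z`, `x`, `x'`. -/
def IsLDP (Q : Mechanism d n) (α : ℝ) : Prop :=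
  ∀ (i : Fin n) (z : Fin (i : ℕ) → Q.Z) (x x' : Fin d) (A : Set Q.Z), MeasurableSet A →
    Q.kernel i (x, z) A ≤ ENNReal.ofReal (Real.exp α) * Q.kernel i (x', z) A

/-- The conditional distribution of the `i`-th private variable given the previous ones, when
the `i`-th individual has a value drawn from `p` independently of the past. -/
def stepKernel (Q : Mechanism d n) (p : Fin d → ℝ) (i : Fin n) :
    Kernel (Fin (i : ℕ) → Q.Z) Q.Z :=
  Q.kernel i ∘ₖ (Kernel.const _ (dataLaw p) ×ₖ Kernel.id)

/-- The joint law of the first `k` private variables when the data are i.i.d. with law `p`. -/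
def lawUpTo (Q : Mechanism d n) (p : Fin d → ℝ) :
    (k : ℕ) → k ≤ n → Measure (Fin k → Q.Z)
  | 0, _ => Measure.dirac (fun i => i.elim0)
  | k + 1, h =>
      (lawUpTo Q p k (Nat.le_of_succ_le h) ⊗ₘ Q.stepKernel p ⟨k, h⟩).map
        (fun y : (Fin k → Q.Z) × Q.Z => (Fin.snoc y.1 y.2 : Fin (k + 1) → Q.Z))

/-- The joint law of the private sample when the data are i.i.d. with law `p`. -/
def law (Q : Mechanism d n) (p : Fin d → ℝ) : Measure (Fin n → Q.Z) :=
  Q.lawUpTo p n le_rfl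

theorem measurable_snoc {Z : Type} [MeasurableSpace Z] (k : ℕ) :
    Measurable (fun y : (Fin k → Z) × Z => (Fin.snoc y.1 y.2 : Fin (k + 1) → Z)) := by
  refine measurable_pi_lambda _ fun i => ?_
  refine Fin.lastCases ?_ (fun j => ?_) i
  · simpa using measurable_snd
  · simpa [Function.comp_def] using (measurable_pi_apply j).comp
      (measurable_fst (α := Fin k → Z) (β := Z))

theorem isMarkovKernel_stepKernel (Q : Mechanism d n) {p : Fin d → ℝ}
    (hp : p ∈ stdSimplex ℝ (Fin d)) (i : Fin n) : IsMarkovKernel (Q.stepKernel p i) := by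
  have := isProbabilityMeasure_dataLaw hp
  unfold stepKernel
  infer_instance

theorem isProbabilityMeasure_lawUpTo (Q : Mechanism d n) {p : Fin d → ℝ}
    (hp : p ∈ stdSimplex ℝ (Fin d)) (k : ℕ) (h : k ≤ n) :
    IsProbabilityMeasure (Q.lawUpTo p k h) := by
  induction k with
  | zero => unfold lawUpTo; infer_instance
  | succ k ih =>
    have h1 := ih (Nat.le_of_succ_le h)
    have h2 : IsMarkovKernel (Q.stepKernel p ⟨k, h⟩) := Q.isMarkovKernel_stepKernel hp _
    unfold lawUpTo
    exact Measure.isProbabilityMeasure_map (measurable_snoc k).aemeasurable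

theorem isProbabilityMeasure_law (Q : Mechanism d n) {p : Fin d → ℝ}
    (hp : p ∈ stdSimplex ℝ (Fin d)) : IsProbabilityMeasure (Q.law p) :=
  Q.isProbabilityMeasure_lawUpTo hp n le_rfl

end Mechanism

/-- The alternative `H₁(δ, 𝕃_r)`: probability vectors at `ℓ_r`-distance at least `δ` of `p₀`. -/
def alternative {d : ℕ} (p₀ : Fin d → ℝ) (δ : ℝ) (r : ℝ≥0∞) : Set (Fin d → ℝ) :=
  {p | p ∈ stdSimplex ℝ (Fin d) ∧ δ ≤ ‖(WithLp.toLp r (p - p₀) : PiLp r (fun _ : Fin d => ℝ))‖}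

/-- The minimax testing risk of the mechanism `Q`: the infimum over the randomized tests
`φ : Z^n → [0, 1]` of the worst sum `𝔼_{p₀} φ + 𝔼_p (1 - φ)` of the two error probabilities
(with the supremum over an empty alternative being `0`). -/
def mechanismRisk {d n : ℕ} (p₀ : Fin d → ℝ) (δ : ℝ) (Q : Mechanism d n) (r : ℝ≥0∞) : ℝ≥0∞ :=
  ⨅ (φ : (Fin n → Q.Z) → ℝ) (_ : Measurable φ) (_ : ∀ z, φ z ∈ Set.Icc (0 : ℝ) 1),
    ⨆ p ∈ alternative p₀ δ r,
      ENNReal.ofReal ((∫ z, φ z ∂(Q.law p₀)) + ∫ z, (1 - φ z) ∂(Q.law p))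

/-- The `α`-LDP minimax testing risk `ℛ_{n,α}(p₀, δ, 𝕃_r)`, over all `α`-LDP sequentially
interactive mechanisms. -/
def minimaxRisk {d : ℕ} (n : ℕ) (α : ℝ) (p₀ : Fin d → ℝ) (δ : ℝ) (r : ℝ≥0∞) : ℝ≥0∞ :=
  ⨅ (Q : Mechanism d n) (_ : Q.IsLDP α), mechanismRisk p₀ δ Q r

/-- The `α`-LDP minimax testing radius
`ℰ_{n,α}(p₀, 𝕃_r) = inf {δ > 0 : ℛ_{n,α}(p₀, δ, 𝕃_r) ≤ γ}`, as an element of `[0, ∞]`. -/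
def testingRadius {d : ℕ} (n : ℕ) (α γ : ℝ) (p₀ : Fin d → ℝ) (r : ℝ≥0∞) : ℝ≥0∞ :=
  ⨅ (δ : ℝ) (_ : 0 < δ) (_ : minimaxRisk n α p₀ δ r ≤ ENNReal.ofReal γ), ENNReal.ofReal δ

/-- The set of the `j ∈ {1, …, d}` with `j^{1/2} / (n α²)^{1/2} ≥ ∑_{j' = j+1}^d p₀(j')`.
The letter `j'` is `j' - 1 : Fin d`, so `j' ≥ j + 1` reads `j ≤ x` for `x = j' - 1`. -/
def jTildeSet {d : ℕ} (n : ℕ) (α : ℝ) (p₀ : Fin d → ℝ) : Set ℕ :=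
  {j | 1 ≤ j ∧ j ≤ d ∧
    (∑ x ∈ Finset.univ.filter (fun x : Fin d => j ≤ (x : ℕ)), p₀ x) ≤
      Real.sqrt (j : ℝ) / Real.sqrt ((n : ℝ) * α ^ 2)}

/-- The smallest element of `jTildeSet`. -/
def jTilde {d : ℕ} (n : ℕ) (α : ℝ) (p₀ : Fin d → ℝ) : ℕ := sInf (jTildeSet n α p₀)

/-- The minimum that defines `jTilde` is attained as soon as `d ≥ 1`. -/
theorem isLeast_jTilde {d : ℕ} (hd : 1 ≤ d) (n : ℕ) (α : ℝ) (p₀ : Fin d → ℝ) :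
    IsLeast (jTildeSet n α p₀) (jTilde n α p₀) := by
  have hne : (jTildeSet n α p₀).Nonempty := by
    refine ⟨d, hd, le_rfl, ?_⟩
    have : (Finset.univ.filter fun x : Fin d => d ≤ (x : ℕ)) = ∅ := by
      ext x; simp [x.isLt]
    rw [this, Finset.sum_empty]
    positivity
  exact ⟨Nat.sInf_mem hne, fun j hj => Nat.sInf_le hj⟩

end LDPTesting

end

noncomputable section

namespace LDPTesting

open scoped BigOperators

/-! ### Mechanisms that tilt the uniform distribution -/

/-! Write `Δ = p - p₀` and `N` for its Euclidean norm. Tilting a uniform report by a bounded query,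
with amplitude `ε = α / 8`, is private. Centering the query at its `p₀`-mean makes the report
uniform under `p₀`, and under `p` its density is `1 + ε ∑ Δ_j q_j`. The first half of the
individuals reports sign vectors, so the score of coordinate `j` is a `±1` walk with drift `ε Δ_j`.
The second half answers a single learned query, the scores clipped to `[-L, L]` and divided by `L`,
through a random sign. Given the scores, the tally of these signs has drift `ε ∑ Δ_j clip L
(score_j) / L` per step, which vanishes under `p₀`; the test rejects when the tally is large. No
dimension appears because clipping keeps the drift: the clipped score has the sign of `Δ_j` and mean
at least of order `min (m |ε Δ_j|) L` (`le_mul_walk_pow_clip`). Once `L ≤ m ε N`, the expected drift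
is therefore at least of order `ε ∑ Δ_j² / N = ε N` (`le_expected_signal`). Its fluctuations are
small as well: each clipped score has variance at most `m` (`walk_pow_clip_variance`) and the
weighted cross terms are nonpositive (`covariance_score_le`), so the signal has variance at most `(m
/ L²) N²`, where `L² = 8192 n / γ`. Chebyshev's inequality then bounds both errors
(`minimaxRisk_le`). For `𝕃₁`, the mass of `p` outside `B` is controlled by `p₀(Bᶜ)` and the
discrepancy on `B`, so Cauchy–Schwarz on `B` reduces to the Euclidean separation. -/

/-- A family of adaptive queries `[d] → [-1, 1]`, indexed by the past and the new report, whose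
average over the new report vanishes. -/
structure QueryScheme (d : ℕ) (Z : Type) [Fintype Z] where
  /-- the query attached to a past and a report -/
  query : (k : ℕ) → (Fin k → Z) → Z → Fin d → ℝ
  abs_query_le : ∀ k z w j, |query k z w j| ≤ 1
  expect_query : ∀ k z j, Finset.univ.expect (fun w => query k z w j) = 0

namespace QueryScheme

variable {d n : ℕ} {Z : Type} [Fintype Z]

/-- The density of the report `w` with respect to the uniform distribution. -/
def density (q : QueryScheme d Z) (ε : ℝ) (p₀ : Fin d → ℝ) {k : ℕ} (z : Fin k → Z) (x : Fin d)
    (w : Z) : ℝ :=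
  1 + ε * (q.query k z w x - ∑ j, p₀ j * q.query k z w j)

theorem abs_sum_mul_query_le (q : QueryScheme d Z) {p₀ : Fin d → ℝ}
    (hp₀ : p₀ ∈ stdSimplex ℝ (Fin d)) {k : ℕ} (z : Fin k → Z) (w : Z) :
    |∑ j, p₀ j * q.query k z w j| ≤ 1 := by
  calc |∑ j, p₀ j * q.query k z w j| ≤ ∑ j, |p₀ j * q.query k z w j| :=
        Finset.abs_sum_le_sum_abs _ _
    _ ≤ ∑ j, p₀ j := by
        refine Finset.sum_le_sum fun j _ => ?_
        rw [abs_mul, abs_of_nonneg (hp₀.1 j)]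
        exact mul_le_of_le_one_right (hp₀.1 j) (q.abs_query_le k z w j)
    _ = 1 := hp₀.2

theorem le_density (q : QueryScheme d Z) {ε : ℝ} (hε : 0 ≤ ε) {p₀ : Fin d → ℝ}
    (hp₀ : p₀ ∈ stdSimplex ℝ (Fin d)) {k : ℕ} (z : Fin k → Z) (x : Fin d) (w : Z) :
    1 - 2 * ε ≤ q.density ε p₀ z x w := by
  have h1 := abs_le.1 (q.abs_sum_mul_query_le hp₀ z w)
  have h2 := abs_le.1 (q.abs_query_le k z w x)
  unfold density
  nlinarith

theorem density_le (q : QueryScheme d Z) {ε : ℝ} (hε : 0 ≤ ε) {p₀ : Fin d → ℝ}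
    (hp₀ : p₀ ∈ stdSimplex ℝ (Fin d)) {k : ℕ} (z : Fin k → Z) (x : Fin d) (w : Z) :
    q.density ε p₀ z x w ≤ 1 + 2 * ε := by
  have h1 := abs_le.1 (q.abs_sum_mul_query_le hp₀ z w)
  have h2 := abs_le.1 (q.abs_query_le k z w x)
  unfold density
  nlinarith

theorem expect_density [Nonempty Z] (q : QueryScheme d Z) (ε : ℝ) (p₀ : Fin d → ℝ) {k : ℕ}
    (z : Fin k → Z) (x : Fin d) :
    Finset.univ.expect (fun w => q.density ε p₀ z x w) = 1 := by
  simp only [density, Finset.expect_add_distrib, ← Finset.mul_expect, Finset.expect_sub_distrib,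
    Finset.expect_sum_comm, expect_query]
  simp

variable [MeasurableSpace Z] [MeasurableSingletonClass Z]

/-- The conditional law of the report of an individual with value `x`. -/
def reportLaw (q : QueryScheme d Z) (ε : ℝ) (p₀ : Fin d → ℝ) {k : ℕ} (z : Fin k → Z)
    (x : Fin d) : Measure Z :=
  ∑ w, ENNReal.ofReal (q.density ε p₀ z x w / Fintype.card Z) • Measure.dirac w

omit [MeasurableSingletonClass Z] in
theorem isProbabilityMeasure_reportLaw [Nonempty Z] (q : QueryScheme d Z) {ε : ℝ} (hε : 0 ≤ ε)
    (hε' : ε ≤ 1 / 2) {p₀ : Fin d → ℝ} (hp₀ : p₀ ∈ stdSimplex ℝ (Fin d)) {k : ℕ}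
    (z : Fin k → Z) (x : Fin d) : IsProbabilityMeasure (q.reportLaw ε p₀ z x) := by
  constructor
  simp only [reportLaw, Measure.coe_finsetSum, Measure.coe_smul, Finset.sum_apply, Pi.smul_apply,
    measure_univ, smul_eq_mul, mul_one]
  rw [← ENNReal.ofReal_sum_of_nonneg, ← Finset.sum_div, ← Fintype.expect_eq_sum_div_card,
    q.expect_density, ENNReal.ofReal_one]
  intro w _
  have := q.le_density hε hp₀ z x w
  exact div_nonneg (by linarith) (by positivity)

/-- The mechanism attached to a query scheme. -/
@[reducible] def mechanism [Nonempty Z] (q : QueryScheme d Z) (n : ℕ) {ε : ℝ} (hε : 0 ≤ ε)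
    (hε' : ε ≤ 1 / 2) {p₀ : Fin d → ℝ} (hp₀ : p₀ ∈ stdSimplex ℝ (Fin d)) : Mechanism d n where
  Z := Z
  mZ := inferInstance
  kernel _ := ⟨fun xz => q.reportLaw ε p₀ xz.2 xz.1, measurable_of_finite _⟩
  markov _ := ⟨fun xz => q.isProbabilityMeasure_reportLaw hε hε' hp₀ xz.2 xz.1⟩

theorem isLDP_mechanism [Nonempty Z] (q : QueryScheme d Z) (n : ℕ) {ε : ℝ} (hε : 0 ≤ ε)
    (hε' : ε ≤ 1 / 2) {p₀ : Fin d → ℝ} (hp₀ : p₀ ∈ stdSimplex ℝ (Fin d)) {α : ℝ}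
    (hα : 1 + 2 * ε ≤ Real.exp α * (1 - 2 * ε)) : (q.mechanism n hε hε' hp₀).IsLDP α := by
  intro i z x x' A _
  change q.reportLaw ε p₀ z x A ≤ _ * q.reportLaw ε p₀ z x' A
  simp only [reportLaw, Measure.coe_finsetSum, Measure.coe_smul, Finset.sum_apply, Pi.smul_apply,
    smul_eq_mul, Finset.mul_sum, ← mul_assoc]
  refine Finset.sum_le_sum fun w _ => ?_
  gcongr
  rw [← ENNReal.ofReal_mul (Real.exp_pos α).le, ← mul_div_assoc]
  refine ENNReal.ofReal_le_ofReal ?_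
  gcongr
  calc _ ≤ 1 + 2 * ε := q.density_le hε hp₀ z x w
    _ ≤ _ := hα
    _ ≤ _ := by
      gcongr
      exact q.le_density hε hp₀ z x' w

theorem integral_reportLaw [Nonempty Z] (q : QueryScheme d Z) {ε : ℝ} (hε : 0 ≤ ε)
    (hε' : ε ≤ 1 / 2) {p₀ : Fin d → ℝ} (hp₀ : p₀ ∈ stdSimplex ℝ (Fin d)) {k : ℕ}
    (z : Fin k → Z) (x : Fin d) (F : Z → ℝ) :
    ∫ w, F w ∂(q.reportLaw ε p₀ z x)
      = Finset.univ.expect (fun w => q.density ε p₀ z x w * F w) := by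
  have h0 (w) : 0 ≤ q.density ε p₀ z x w / Fintype.card Z := by
    have := q.le_density hε hp₀ z x w
    exact div_nonneg (by linarith) (by positivity)
  rw [reportLaw, integral_finsetSum_measure, Fintype.expect_eq_sum_div_card, Finset.sum_div]
  · refine Finset.sum_congr rfl fun w _ => ?_
    rw [integral_smul_measure, integral_dirac, ENNReal.toReal_ofReal (h0 w), smul_eq_mul]
    ring
  · intro w _
    have : IsFiniteMeasure (ENNReal.ofReal (q.density ε p₀ z x w / Fintype.card Z) •
      Measure.dirac w) := Measure.smul_finite _ ENNReal.ofReal_ne_top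
    exact Integrable.of_finite

theorem integral_dataLaw {p : Fin d → ℝ} (hp : p ∈ stdSimplex ℝ (Fin d)) (F : Fin d → ℝ) :
    ∫ x, F x ∂(dataLaw p) = ∑ x, p x * F x := by
  rw [dataLaw, integral_finsetSum_measure]
  · refine Finset.sum_congr rfl fun x _ => ?_
    rw [integral_smul_measure, integral_dirac, ENNReal.toReal_ofReal (hp.1 x), smul_eq_mul]
  · intro x _
    have : IsFiniteMeasure (ENNReal.ofReal (p x) • Measure.dirac x) :=
      Measure.smul_finite _ ENNReal.ofReal_ne_top
    exact Integrable.of_finite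

/-- The centering by `p₀` turns the averaged tilt into one by `p - p₀`, so reports are exactly
uniform under `p₀`. -/
theorem integral_stepKernel [Nonempty Z] (q : QueryScheme d Z) {ε : ℝ} (hε : 0 ≤ ε)
    (hε' : ε ≤ 1 / 2) {p₀ : Fin d → ℝ} (hp₀ : p₀ ∈ stdSimplex ℝ (Fin d))
    {p : Fin d → ℝ} (hp : p ∈ stdSimplex ℝ (Fin d)) (i : Fin n) (z : Fin i → Z) (F : Z → ℝ) :
    ∫ w, F w ∂((q.mechanism n hε hε' hp₀).stepKernel p i z) = Finset.univ.expect
      (fun w => (1 + ε * ∑ j, (p j - p₀ j) * q.query i z w j) * F w) := by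
  have := isProbabilityMeasure_dataLaw hp
  have hK := (q.mechanism n hε hε' hp₀).isMarkovKernel_stepKernel hp i
  unfold Mechanism.stepKernel at hK ⊢
  rw [Kernel.integral_comp Integrable.of_finite, Kernel.prod_apply, Kernel.const_apply,
    Kernel.id_apply, integral_prod _ Integrable.of_finite]
  simp only [integral_dirac]
  rw [integral_dataLaw hp]
  have h (x : Fin d) : ∫ w, F w ∂((q.mechanism n hε hε' hp₀).kernel i (x, z))
      = Finset.univ.expect (fun w => q.density ε p₀ z x w * F w) :=
    q.integral_reportLaw hε hε' hp₀ z x F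
  simp only [h, Finset.mul_expect, ← Finset.expect_sum_comm]
  refine Finset.expect_congr rfl fun w _ => ?_
  simp only [← mul_assoc, ← Finset.sum_mul]
  congr 1
  simp only [density, mul_add, mul_one, Finset.sum_add_distrib, hp.2, mul_sub, sub_mul,
    Finset.sum_sub_distrib, ← Finset.sum_mul, one_mul]
  congr 2
  rw [Finset.mul_sum]
  exact Finset.sum_congr rfl fun x _ => by ring

theorem integral_lawUpTo_succ [Nonempty Z] (q : QueryScheme d Z) {ε : ℝ} (hε : 0 ≤ ε)
    (hε' : ε ≤ 1 / 2) {p₀ : Fin d → ℝ} (hp₀ : p₀ ∈ stdSimplex ℝ (Fin d))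
    {p : Fin d → ℝ} (hp : p ∈ stdSimplex ℝ (Fin d)) {k : ℕ} (h : k + 1 ≤ n)
    (F : (Fin (k + 1) → Z) → ℝ) :
    ∫ z, F z ∂((q.mechanism n hε hε' hp₀).lawUpTo p (k + 1) h) =
      ∫ z, Finset.univ.expect
        (fun w => (1 + ε * ∑ j, (p j - p₀ j) * q.query k z w j) * F (Fin.snoc z w))
        ∂((q.mechanism n hε hε' hp₀).lawUpTo p k (Nat.le_of_succ_le h)) := by
  have h1 := (q.mechanism n hε hε' hp₀).isProbabilityMeasure_lawUpTo hp k (Nat.le_of_succ_le h)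
  have hK := (q.mechanism n hε hε' hp₀).isMarkovKernel_stepKernel hp ⟨k, h⟩
  rw [Mechanism.lawUpTo, integral_map (Mechanism.measurable_snoc k).aemeasurable
    (measurable_of_finite _).aestronglyMeasurable, Measure.integral_compProd Integrable.of_finite]
  refine integral_congr_ae (Filter.Eventually.of_forall fun z => ?_)
  exact q.integral_stepKernel hε hε' hp₀ hp ⟨k, h⟩ z _

end QueryScheme

/-! ### The biased walk -/

/-- One step of the `±1` walk with drift `θ`, acting on functions. -/
def walk (θ : ℝ) : Module.End ℝ (ℝ → ℝ) where
  toFun f s := (1 + θ) / 2 * f (s + 1) + (1 - θ) / 2 * f (s - 1)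
  map_add' f g := by ext s; simp only [Pi.add_apply]; ring
  map_smul' c f := by ext s; simp only [Pi.smul_apply, smul_eq_mul, RingHom.id_apply]; ring

theorem walk_apply (θ : ℝ) (f : ℝ → ℝ) (s : ℝ) :
    walk θ f s = (1 + θ) / 2 * f (s + 1) + (1 - θ) / 2 * f (s - 1) := rfl

theorem walk_mono {θ : ℝ} (hθ : |θ| ≤ 1) {f g : ℝ → ℝ} (h : f ≤ g) : walk θ f ≤ walk θ g := by
  intro s
  have := abs_le.1 hθ
  rw [walk_apply, walk_apply]
  gcongr
  · linarith
  · exact h _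
  · linarith
  · exact h _

theorem walk_pow_mono {θ : ℝ} (hθ : |θ| ≤ 1) (k : ℕ) {f g : ℝ → ℝ} (h : f ≤ g) :
    (walk θ ^ k) f ≤ (walk θ ^ k) g := by
  induction k generalizing f g with
  | zero => exact h
  | succ k ih => simpa only [pow_succ, Module.End.mul_apply] using ih (walk_mono hθ h)

theorem monotone_walk {θ : ℝ} (hθ : |θ| ≤ 1) {f : ℝ → ℝ} (h : Monotone f) :
    Monotone (walk θ f) := by
  intro s t hst
  have := abs_le.1 hθ
  rw [walk_apply, walk_apply]
  gcongr
  · linarith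
  · exact h (by linarith)
  · linarith
  · exact h (by linarith)

/-- Both operators are combinations of translations. This allows telescoping `walk θ ^ m - walk 0 ^
m`. -/
theorem walk_commute (θ η : ℝ) : Commute (walk θ) (walk η) := by
  ext f s
  simp only [Module.End.mul_apply, walk_apply]
  ring_nf

/-- These are the exact first two moments of the walk. Every later estimate compares a function with
a quadratic and evaluates it here. -/
theorem walk_pow_quadratic (θ : ℝ) (k : ℕ) (a b c : ℝ) :
    (walk θ ^ k) (fun s => a * s ^ 2 + b * s + c) =
      fun s => a * ((s + k * θ) ^ 2 + k * (1 - θ ^ 2)) + b * (s + k * θ) + c := by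
  induction k generalizing b c with
  | zero => ext s; simp
  | succ k ih =>
    rw [pow_succ, Module.End.mul_apply]
    have : walk θ (fun s => a * s ^ 2 + b * s + c)
        = fun s => a * s ^ 2 + (2 * a * θ + b) * s + (a + b * θ + c) := by
      ext s; rw [walk_apply]; ring
    rw [this, ih]
    ext s
    push_cast
    ring

/-- Truncation to `[-L, L]`. -/
def clip (L s : ℝ) : ℝ := max (-L) (min s L)

theorem monotone_clip (L : ℝ) : Monotone (clip L) := fun s t h => by
  unfold clip; gcongr

theorem abs_clip_le {L : ℝ} (hL : 0 ≤ L) (s : ℝ) : |clip L s| ≤ L :=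
  abs_le.2 ⟨le_max_left _ _, max_le (by linarith) (min_le_right _ _)⟩

theorem clip_of_abs_le {L s : ℝ} (h : |s| ≤ L) : clip L s = s := by
  have := abs_le.1 h
  rw [clip, min_eq_left this.2, max_eq_right this.1]

theorem clip_neg {L : ℝ} (hL : 0 ≤ L) (s : ℝ) : clip L (-s) = -clip L s := by
  unfold clip
  rcases le_total s L with h | h <;> rcases le_total s (-L) with h' | h' <;>
    simp only [min_def, max_def] <;> split_ifs <;> linarith

theorem abs_clip_sub_clip_le (L s t : ℝ) : |clip L s - clip L t| ≤ |s - t| := by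
  unfold clip
  calc _ ≤ |min s L - min t L| := by
        simpa [max_comm] using abs_max_sub_max_le_abs (min s L) (min t L) (-L)
    _ ≤ |s - t| := abs_min_sub_min_le_max s L t L |>.trans (by simp)

theorem walk_pow_neg (θ : ℝ) (k : ℕ) (f : ℝ → ℝ) (s : ℝ) :
    (walk (-θ) ^ k) f s = (walk θ ^ k) (fun t => f (-t)) (-s) := by
  induction k generalizing f s with
  | zero => simp
  | succ k ih =>
    rw [pow_succ, pow_succ, Module.End.mul_apply, Module.End.mul_apply, ih]
    refine congrArg (fun f => (walk θ ^ k) f (-s)) (funext fun t => ?_)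
    rw [walk_apply, walk_apply]
    ring_nf

theorem walk_pow_clip_neg {L : ℝ} (hL : 0 ≤ L) (θ : ℝ) (k : ℕ) :
    (walk (-θ) ^ k) (clip L) 0 = -(walk θ ^ k) (clip L) 0 := by
  rw [walk_pow_neg]
  have : (fun t => clip L (-t)) = -clip L := by ext t; simp [clip_neg hL]
  rw [this, map_neg, neg_zero, Pi.neg_apply]

theorem walk_zero_pow_clip {L : ℝ} (hL : 0 ≤ L) (k : ℕ) : (walk 0 ^ k) (clip L) 0 = 0 := by
  have := walk_pow_clip_neg hL 0 k
  rw [neg_zero] at this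
  linarith

/-- The symmetric difference quotient at scale `1`. -/
def centralDiff : Module.End ℝ (ℝ → ℝ) where
  toFun f s := (f (s + 1) - f (s - 1)) / 2
  map_add' f g := by ext s; simp only [Pi.add_apply]; ring
  map_smul' c f := by ext s; simp only [Pi.smul_apply, smul_eq_mul, RingHom.id_apply]; ring

theorem walk_sub_walk_zero (θ : ℝ) : walk θ - walk 0 = θ • centralDiff := by
  ext f s
  simp only [LinearMap.sub_apply, LinearMap.smul_apply, Pi.sub_apply, Pi.smul_apply, smul_eq_mul,
    walk_apply]
  change _ = θ * ((f (s + 1) - f (s - 1)) / 2)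
  ring

/-- The quotient equals `1` for `|s| ≤ L / 2`, and elsewhere it is nonnegative while the quadratic
is nonpositive. -/
theorem le_centralDiff_clip {L : ℝ} (hL : 2 ≤ L) (s : ℝ) :
    -4 / L ^ 2 * s ^ 2 + 0 * s + 1 ≤ centralDiff (clip L) s := by
  change _ ≤ (clip L (s + 1) - clip L (s - 1)) / 2
  rcases le_total |s| (L / 2) with h | h
  · have := abs_le.1 h
    rw [clip_of_abs_le (abs_le.2 ⟨by linarith, by linarith⟩),
      clip_of_abs_le (abs_le.2 ⟨by linarith, by linarith⟩)]
    have : 0 ≤ 4 / L ^ 2 * s ^ 2 := by positivity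
    rw [neg_div]
    linarith
  · have h1 : clip L (s - 1) ≤ clip L (s + 1) := monotone_clip L (by linarith)
    have h2 : (L / 2) ^ 2 ≤ s ^ 2 := by
      rw [← sq_abs s]; gcongr
    have h3 : 1 ≤ 4 / L ^ 2 * s ^ 2 := by
      rw [div_mul_eq_mul_div, one_le_div (by positivity)]
      linarith
    rw [neg_div]
    linarith

/-- The driftless clipped mean is zero by oddness. Telescoping writes the mean as `θ` times a sum of
expected difference quotients at walks with `i` drifting and `m - 1 - i` driftless steps. Such walks
mostly stay within the unclipped region, so each expectation is at least `1 / 2`. -/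
theorem le_walk_pow_clip_of_small {L θ : ℝ} {m : ℕ} (hL : 2 ≤ L) (hθ : 0 ≤ θ) (hθ1 : θ ≤ 1)
    (hm : 16 * m ≤ L ^ 2) (hmθ : m * θ ≤ L / 4) :
    m * θ / 2 ≤ (walk θ ^ m) (clip L) 0 := by
  have habs : |θ| ≤ 1 := by rwa [abs_of_nonneg hθ]
  have key := (walk_commute θ 0).mul_geom_sum₂ m
  rw [walk_sub_walk_zero] at key
  have hc : Commute (θ • centralDiff) (∑ i ∈ Finset.range m, walk θ ^ i * walk 0 ^ (m - 1 - i)) := by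
    rw [← walk_sub_walk_zero]
    refine Commute.sum_right _ _ _ fun i _ => ?_
    have h1 : Commute (walk θ - walk 0) (walk θ) :=
      (Commute.refl _).sub_left (walk_commute _ _)
    have h2 : Commute (walk θ - walk 0) (walk 0) :=
      (walk_commute _ _).sub_left (Commute.refl _)
    exact (h1.pow_right _).mul_right (h2.pow_right _)
  rw [hc.eq] at key
  have key2 := congrFun (LinearMap.congr_fun key (clip L)) 0
  simp only [LinearMap.sub_apply, Pi.sub_apply, walk_zero_pow_clip (by linarith : 0 ≤ L), sub_zero,
    Module.End.mul_apply, LinearMap.sum_apply, LinearMap.smul_apply, map_smul, Finset.sum_apply,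
    Pi.smul_apply, smul_eq_mul] at key2
  rw [← key2]
  have hterm : ∀ i ∈ Finset.range m,
      θ * (1 / 2) ≤ θ * (walk θ ^ i) ((walk 0 ^ (m - 1 - i)) (centralDiff (clip L))) 0 := by
    intro i hi
    have him : i + (m - 1 - i) ≤ m := by have := Finset.mem_range.1 hi; omega
    have hi' : (i : ℝ) ≤ m := by exact_mod_cast (Finset.mem_range.1 hi).le
    have him' : (i : ℝ) + ((m - 1 - i : ℕ) : ℝ) ≤ m := by exact_mod_cast him
    gcongr
    have h := walk_pow_mono habs i (walk_pow_mono (θ := 0) (by simp) (m - 1 - i)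
      (fun s => le_centralDiff_clip hL s)) 0
    rw [walk_pow_quadratic] at h
    have e : (fun s : ℝ => -4 / L ^ 2 * ((s + ((m - 1 - i : ℕ) : ℝ) * 0) ^ 2
        + ((m - 1 - i : ℕ) : ℝ) * (1 - 0 ^ 2)) + 0 * (s + ((m - 1 - i : ℕ) : ℝ) * 0) + 1) =
        fun s => -4 / L ^ 2 * s ^ 2 + 0 * s + (1 - 4 / L ^ 2 * ((m - 1 - i : ℕ) : ℝ)) := by
      ext s; ring
    rw [e, walk_pow_quadratic] at h
    refine le_trans ?_ h
    have h1 : (i * θ) ^ 2 ≤ (L / 4) ^ 2 := by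
      have : i * θ ≤ m * θ := by gcongr
      gcongr
      linarith
    have h2 : (i : ℝ) * (1 - θ ^ 2) ≤ i := by
      have : 0 ≤ (i : ℝ) * θ ^ 2 := by positivity
      linarith
    -- The second moment is at most `L² / 16 + m ≤ L² / 8`.
    have h3 : 4 / L ^ 2 * ((i * θ) ^ 2 + i * (1 - θ ^ 2) + ((m - 1 - i : ℕ) : ℝ)) ≤ 1 / 2 := by
      rw [div_mul_eq_mul_div, div_le_iff₀ (by positivity)]
      linarith
    rw [neg_div]
    linarith
  calc m * θ / 2 = ∑ _i ∈ Finset.range m, θ * (1 / 2) := by simp; ring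
    _ ≤ _ := (Finset.sum_le_sum hterm).trans_eq (Finset.mul_sum _ _ _).symm

/-- The walk ends within about `√m ≤ L / 8` of its mean, which exceeds `L / 4`. The bound `clip L s
≥ L / 4 - |s - m θ|` is made quadratic by the arithmetic-geometric inequality, so that the variance
suffices. -/
theorem le_walk_pow_clip_of_large {L θ : ℝ} {m : ℕ} (hL : 2 ≤ L) (hθ : 0 ≤ θ) (hθ1 : θ ≤ 1)
    (hm : 64 * m ≤ L ^ 2) (hmθ : L / 4 ≤ m * θ) :
    L / 16 ≤ (walk θ ^ m) (clip L) 0 := by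
  have habs : |θ| ≤ 1 := by rwa [abs_of_nonneg hθ]
  have hL0 : 0 < L := by linarith
  have hpt : ∀ s : ℝ, -2 / L * s ^ 2 + 4 * (m * θ) / L * s + (L / 8 - 2 * (m * θ) ^ 2 / L)
      ≤ clip L s := by
    intro s
    have h1 : L / 4 - |s - m * θ| ≤ clip L s := by
      rcases le_total s (L / 4) with h | h
      · rw [abs_of_nonpos (by linarith)]
        have : s ≤ clip L s := by
          unfold clip; rw [min_eq_left (by linarith)]; exact le_max_right _ _
        linarith
      · have : clip L (L / 4) ≤ clip L s := monotone_clip L h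
        rw [clip_of_abs_le (abs_le.2 ⟨by linarith, by linarith⟩)] at this
        linarith [abs_nonneg (s - m * θ)]
    have h2 : |s - m * θ| ≤ L / 8 + 2 * (s - m * θ) ^ 2 / L := by
      rw [← sub_le_iff_le_add', le_div_iff₀ hL0, ← sq_abs (s - m * θ)]
      nlinarith [sq_nonneg (4 * |s - m * θ| - L)]
    calc _ = L / 4 - (L / 8 + 2 * (s - m * θ) ^ 2 / L) := by field_simp; ring
      _ ≤ _ := by linarith
  have h := walk_pow_mono habs m (fun s => hpt s) 0
  rw [walk_pow_quadratic] at h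
  refine le_trans ?_ h
  beta_reduce
  have h3 : (m : ℝ) * (1 - θ ^ 2) ≤ L ^ 2 / 64 := by
    have : 0 ≤ (m : ℝ) * θ ^ 2 := by positivity
    linarith
  have e : -2 / L * ((0 + m * θ) ^ 2 + m * (1 - θ ^ 2)) + 4 * (m * θ) / L * (0 + m * θ)
      + (L / 8 - 2 * (m * θ) ^ 2 / L) = L / 8 - 2 * (m * (1 - θ ^ 2)) / L := by
    field_simp; ring
  rw [e]
  have : 2 * (m * (1 - θ ^ 2)) / L ≤ L / 32 := by
    rw [div_le_iff₀ hL0]; nlinarith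
  linarith

/-- The truncated walk keeps its drift up to constants. -/
theorem le_mul_walk_pow_clip {L θ : ℝ} {m : ℕ} (hL : 2 ≤ L) (hθ : |θ| ≤ 1)
    (hm : 64 * m ≤ L ^ 2) :
    |θ| * min (m * |θ|) L / 16 ≤ θ * (walk θ ^ m) (clip L) 0 := by
  wlog h : 0 ≤ θ generalizing θ with H
  · have := H (θ := -θ) (by rwa [abs_neg]) (by linarith)
    rwa [abs_neg, walk_pow_clip_neg (by linarith), neg_mul_neg] at this
  rw [abs_of_nonneg h] at hθ ⊢
  rw [mul_div_assoc]
  gcongr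
  rcases le_total (m * θ) (L / 4) with h1 | h1
  · have h2 := le_walk_pow_clip_of_small hL h hθ (by linarith [m.cast_nonneg (α := ℝ)]) h1
    have : 0 ≤ m * θ := by positivity
    linarith [min_le_left (m * θ) L]
  · linarith [le_walk_pow_clip_of_large hL h hθ hm h1, min_le_right (m * θ) L]

theorem walk_pow_const (θ : ℝ) (k : ℕ) (c s : ℝ) : (walk θ ^ k) (fun _ => c) s = c := by
  have := walk_pow_quadratic θ k 0 0 c
  simp only [zero_mul, zero_add] at this
  rw [this]

/-- The variance of the truncated walk is at most its number of steps. -/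
theorem walk_pow_clip_variance {L θ : ℝ} (hθ : |θ| ≤ 1) (m : ℕ) :
    (walk θ ^ m) (fun s => (clip L s - (walk θ ^ m) (clip L) 0) ^ 2) 0 ≤ m := by
  set a := (walk θ ^ m) (clip L) 0 with ha
  -- With `c = clip L (m θ)`, expand around `c` and use that `clip` is 1-Lipschitz. The correction
  -- terms have mean `-(c - a) ^ 2 ≤ 0`, leaving the variance of the unclipped walk.
  have hle : ∀ s : ℝ, (clip L s - a) ^ 2 ≤ ((1 : ℝ) * s ^ 2 + (-(2 * (m * θ))) * s + (m * θ) ^ 2)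
      + (2 * (clip L (m * θ) - a)) * clip L s
      + (a ^ 2 - clip L (m * θ) ^ 2) := by
    intro s
    have := sq_le_sq.2 (abs_clip_sub_clip_le L s (m * θ))
    nlinarith
  have h := walk_pow_mono hθ m (fun s => hle s) 0
  have e : (fun s : ℝ => ((1 : ℝ) * s ^ 2 + (-(2 * (m * θ))) * s + (m * θ) ^ 2)
      + (2 * (clip L (m * θ) - a)) * clip L s + (a ^ 2 - clip L (m * θ) ^ 2)) =
      (fun s : ℝ => (1 : ℝ) * s ^ 2 + (-(2 * (m * θ))) * s + (m * θ) ^ 2)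
      + (2 * (clip L (m * θ) - a)) • clip L + (fun _ => a ^ 2 - clip L (m * θ) ^ 2) := by
    ext s; simp
  rw [e, map_add, map_add, map_smul, walk_pow_quadratic] at h
  simp only [Pi.add_apply, Pi.smul_apply, smul_eq_mul, walk_pow_const, ← ha] at h
  refine h.trans ?_
  have : 0 ≤ (m : ℝ) * θ ^ 2 := by positivity
  nlinarith [sq_nonneg (clip L (m * θ) - a)]

/-! ### The two-stage mechanism -/

/-- The public reports: a vector of signs, used in the first stage, and a single sign, used in the
second one. -/
abbrev Report (d : ℕ) := (Fin d → Bool) × Bool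

/-- The sign attached to a bit. -/
def bitSign (b : Bool) : ℝ := if b then 1 else -1

theorem bitSign_not (b : Bool) : bitSign (!b) = -bitSign b := by cases b <;> simp [bitSign]

theorem bitSign_mul_self (b : Bool) : bitSign b * bitSign b = 1 := by cases b <;> simp [bitSign]

theorem abs_bitSign (b : Bool) : |bitSign b| = 1 := by cases b <;> simp [bitSign]

theorem apply_add_bitSign (f : ℝ → ℝ) (s : ℝ) (b : Bool) :
    f (s + bitSign b) = (f (s + 1) + f (s - 1)) / 2 + (f (s + 1) - f (s - 1)) / 2 * bitSign b := by
  cases b <;> simp [bitSign, sub_eq_add_neg] <;> ring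

theorem expect_eq_zero_of_neg {Z : Type*} [Fintype Z] (e : Z ≃ Z) (F : Z → ℝ)
    (h : ∀ w, F (e w) = -F w) : Finset.univ.expect F = 0 := by
  have h1 : Finset.univ.expect (fun w => F (e w)) = Finset.univ.expect F :=
    Fintype.expect_equiv e _ _ fun _ => rfl
  simp only [h, Finset.expect_neg_distrib] at h1
  linarith

/-! ### Low-order moments of random signs under a linear tilt. -/

section Signs

variable {d : ℕ}

/-- Flipping the signs of the coordinates selected by `c`. -/
def flipSigns (c : Fin d → Bool) : Report d ≃ Report d where
  toFun w := (fun j => xor (c j) (w.1 j), w.2)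
  invFun w := (fun j => xor (c j) (w.1 j), w.2)
  left_inv w := by simp
  right_inv w := by simp

theorem bitSign_flipSigns (c : Fin d → Bool) (w : Report d) (j : Fin d) :
    bitSign ((flipSigns c w).1 j) = bitSign (c j) * -bitSign (w.1 j) := by
  change bitSign (xor (c j) (w.1 j)) = _
  cases c j <;> cases w.1 j <;> simp [bitSign]

theorem expect_bitSign (j : Fin d) :
    Finset.univ.expect (fun w : Report d => bitSign (w.1 j)) = 0 :=
  expect_eq_zero_of_neg (flipSigns fun _ => true) _ fun w => by
    simp only [bitSign_flipSigns]; simp [bitSign]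

theorem expect_bitSign_snd : Finset.univ.expect (fun w : Report d => bitSign w.2) = 0 :=
  expect_eq_zero_of_neg ((Equiv.refl _).prodCongr Equiv.boolNot) _ fun w => by
    simp [bitSign_not]

theorem expect_bitSign_mul (i j : Fin d) :
    Finset.univ.expect (fun w : Report d => bitSign (w.1 i) * bitSign (w.1 j))
      = if i = j then 1 else 0 := by
  split_ifs with h
  · subst h
    simp [bitSign_mul_self]
  · exact expect_eq_zero_of_neg (flipSigns fun l => decide (l = i)) _ fun w => by
      simp only [bitSign_flipSigns]
      simp [bitSign, Ne.symm h]

theorem expect_bitSign_mul_mul (i j l : Fin d) :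
    Finset.univ.expect
      (fun w : Report d => bitSign (w.1 i) * bitSign (w.1 j) * bitSign (w.1 l)) = 0 :=
  expect_eq_zero_of_neg (flipSigns fun _ => true) _ fun w => by
    simp only [bitSign_flipSigns, show bitSign true = 1 by simp [bitSign]]
    ring

theorem expect_tilt_mul (ε : ℝ) (Δ : Fin d → ℝ) (i : Fin d) (a b : ℝ) :
    Finset.univ.expect (fun w : Report d =>
      (1 + ε * ∑ l, Δ l * bitSign (w.1 l)) * (a + b * bitSign (w.1 i))) = a + b * (ε * Δ i) := by
  have h : ∀ w : Report d, (1 + ε * ∑ l, Δ l * bitSign (w.1 l)) * (a + b * bitSign (w.1 i)) =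
      a + b * bitSign (w.1 i) + ε * ∑ l, (Δ l * (a * bitSign (w.1 l)
        + b * (bitSign (w.1 i) * bitSign (w.1 l)))) := by
    intro w
    rw [add_mul, one_mul, mul_assoc, Finset.sum_mul]
    congr 2
    exact Finset.sum_congr rfl fun l _ => by ring
  simp only [h, Finset.expect_add_distrib, ← Finset.mul_expect, Finset.expect_sum_comm,
    expect_bitSign, expect_bitSign_mul]
  simp
  ring

/-- A linear tilt leaves `w_i w_j` with mean zero, so the two signs have covariance minus the
product of their drifts; this is the correction term. -/
theorem expect_tilt_mul_mul (ε : ℝ) (Δ : Fin d → ℝ) {i j : Fin d} (hij : i ≠ j)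
    (a b a' b' : ℝ) :
    Finset.univ.expect (fun w : Report d => (1 + ε * ∑ l, Δ l * bitSign (w.1 l)) *
      ((a + b * bitSign (w.1 i)) * (a' + b' * bitSign (w.1 j)))) =
      (a + b * (ε * Δ i)) * (a' + b' * (ε * Δ j)) - b * b' * ((ε * Δ i) * (ε * Δ j)) := by
  have h : ∀ w : Report d, (1 + ε * ∑ l, Δ l * bitSign (w.1 l)) *
      ((a + b * bitSign (w.1 i)) * (a' + b' * bitSign (w.1 j))) =
      a * a' + a * b' * bitSign (w.1 j) + b * a' * bitSign (w.1 i)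
        + b * b' * (bitSign (w.1 i) * bitSign (w.1 j))
        + ε * ∑ l, (Δ l * (a * a' * bitSign (w.1 l) + a * b' * (bitSign (w.1 j) * bitSign (w.1 l))
          + b * a' * (bitSign (w.1 i) * bitSign (w.1 l))
          + b * b' * (bitSign (w.1 i) * bitSign (w.1 j) * bitSign (w.1 l)))) := by
    intro w
    rw [add_mul, one_mul, mul_assoc, Finset.sum_mul]
    congr 1
    · ring
    · congr 1
      exact Finset.sum_congr rfl fun l _ => by ring
  simp only [h, Finset.expect_add_distrib, ← Finset.mul_expect, Finset.expect_sum_comm,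
    expect_bitSign, expect_bitSign_mul, expect_bitSign_mul_mul, hij]
  simp [mul_add, Finset.sum_add_distrib]
  ring

/-- The sum of the first `m` reported sign vectors. -/
def score (m : ℕ) {k : ℕ} (z : Fin k → Report d) (j : Fin d) : ℝ :=
  ∑ i : Fin k, if (i : ℕ) < m then bitSign ((z i).1 j) else 0

/-- The sum of the single signs reported after the first `m` reports. -/
def tally (m : ℕ) {k : ℕ} (z : Fin k → Report d) : ℝ :=
  ∑ i : Fin k, if (i : ℕ) < m then 0 else bitSign (z i).2

theorem score_snoc_of_lt {m k : ℕ} (h : k < m) (z : Fin k → Report d) (w : Report d) (j : Fin d) :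
    score m (Fin.snoc z w : Fin (k + 1) → Report d) j = score m z j + bitSign (w.1 j) := by
  simp [score, Fin.sum_univ_castSucc, h]

theorem score_snoc_of_le {m k : ℕ} (h : m ≤ k) (z : Fin k → Report d) (w : Report d) :
    score m (Fin.snoc z w : Fin (k + 1) → Report d) = score m z := by
  ext j
  simp [score, Fin.sum_univ_castSucc, h]

theorem tally_snoc_of_le {m k : ℕ} (h : m ≤ k) (z : Fin k → Report d) (w : Report d) :
    tally m (Fin.snoc z w : Fin (k + 1) → Report d) = tally m z + bitSign w.2 := by
  simp [tally, Fin.sum_univ_castSucc, h]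

theorem tally_eq_zero {m : ℕ} (z : Fin m → Report d) : tally m z = 0 := by
  simp [tally]

/-- In the first stage the individuals report random sign vectors; in the second stage they answer
the query given by the truncated scores of the first stage. -/
def twoStageScheme (d m : ℕ) {L : ℝ} (hL : 0 < L) : QueryScheme d (Report d) where
  query k z w j := if k < m then bitSign (w.1 j) else bitSign w.2 * (clip L (score m z j) / L)
  abs_query_le k z w j := by
    split_ifs
    · exact (abs_bitSign _).le
    · rw [abs_mul, abs_bitSign, one_mul, abs_div, abs_of_pos hL]
      exact div_le_one_of_le₀ (abs_clip_le hL.le _) hL.le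
  expect_query k z j := by
    by_cases h : k < m
    · simp only [h, if_true, expect_bitSign]
    · simp only [h, if_false, ← Finset.expect_mul, expect_bitSign_snd, zero_mul]

end Signs

/-! ### Means, variances and covariances of the scores and of the tally. -/

section Moments

variable {d n m : ℕ} {L ε : ℝ} {p₀ p : Fin d → ℝ}

/-- The law of the first `k` reports of the two-stage mechanism. -/
abbrev twoStageLaw (m : ℕ) (hL : 0 < L) (hε : 0 ≤ ε) (hε' : ε ≤ 1 / 2)
    (hp₀ : p₀ ∈ stdSimplex ℝ (Fin d)) (p : Fin d → ℝ) (k : ℕ) (h : k ≤ n) :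
    Measure (Fin k → Report d) :=
  ((twoStageScheme d m hL).mechanism n hε hε' hp₀).lawUpTo p k h

theorem abs_drift_le (hε : 0 ≤ ε) (hε' : ε ≤ 1 / 2) (hp₀ : p₀ ∈ stdSimplex ℝ (Fin d))
    (hp : p ∈ stdSimplex ℝ (Fin d)) (j : Fin d) : |ε * (p j - p₀ j)| ≤ 1 := by
  have h1 : p j ≤ 1 := hp.2 ▸ Finset.single_le_sum (fun i _ => hp.1 i) (Finset.mem_univ j)
  have h2 : p₀ j ≤ 1 := hp₀.2 ▸ Finset.single_le_sum (fun i _ => hp₀.1 i) (Finset.mem_univ j)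
  have h3 : |p j - p₀ j| ≤ 1 := abs_le.2 ⟨by linarith [hp.1 j], by linarith [hp₀.1 j]⟩
  rw [abs_mul, abs_of_nonneg hε]
  nlinarith [abs_nonneg (p j - p₀ j)]

variable (hL : 0 < L) (hε : 0 ≤ ε) (hε' : ε ≤ 1 / 2) (hp₀ : p₀ ∈ stdSimplex ℝ (Fin d))
  (hp : p ∈ stdSimplex ℝ (Fin d))
include hp

theorem integral_twoStageLaw_succ_of_lt {k : ℕ} (h : k + 1 ≤ n) (hk : k < m)
    (F : (Fin (k + 1) → Report d) → ℝ) :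
    ∫ z, F z ∂(twoStageLaw m hL hε hε' hp₀ p (k + 1) h) =
      ∫ z, Finset.univ.expect (fun w : Report d =>
        (1 + ε * ∑ j, (p j - p₀ j) * bitSign (w.1 j)) * F (Fin.snoc z w))
        ∂(twoStageLaw m hL hε hε' hp₀ p k (Nat.le_of_succ_le h)) := by
  rw [QueryScheme.integral_lawUpTo_succ _ hε hε' hp₀ hp h F]
  have h1 (z : Fin k → Report d) (w : Report d) (j : Fin d) :
      (twoStageScheme d m hL).query k z w j = bitSign (w.1 j) := by
    simp only [twoStageScheme, hk, if_true]
  simp only [h1]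

/-- The correlation of the second stage query with the perturbation `Δ`. -/
def signal (L : ℝ) (Δ s : Fin d → ℝ) : ℝ := ∑ j, Δ j * (clip L (s j) / L)

theorem integral_twoStageLaw_succ_of_le {k : ℕ} (h : k + 1 ≤ n) (hk : m ≤ k)
    (F : (Fin (k + 1) → Report d) → ℝ) :
    ∫ z, F z ∂(twoStageLaw m hL hε hε' hp₀ p (k + 1) h) =
      ∫ z, Finset.univ.expect (fun w : Report d =>
        (1 + bitSign w.2 * (ε * signal L (p - p₀) (score m z))) * F (Fin.snoc z w))
        ∂(twoStageLaw m hL hε hε' hp₀ p k (Nat.le_of_succ_le h)) := by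
  rw [QueryScheme.integral_lawUpTo_succ _ hε hε' hp₀ hp h F]
  have h1 (z : Fin k → Report d) (w : Report d) :
      ε * ∑ j, (p j - p₀ j) * (twoStageScheme d m hL).query k z w j =
        bitSign w.2 * (ε * signal L (p - p₀) (score m z)) := by
    simp only [twoStageScheme, not_lt.2 hk, if_false, signal, Finset.mul_sum, Pi.sub_apply]
    exact Finset.sum_congr rfl fun j _ => by ring
  simp only [h1]

theorem integral_score {k : ℕ} (h : k ≤ n) (hk : k ≤ m) (f : ℝ → ℝ) (j : Fin d) :
    ∫ z, f (score m z j) ∂(twoStageLaw m hL hε hε' hp₀ p k h) =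
      (walk (ε * (p j - p₀ j)) ^ k) f 0 := by
  induction k generalizing f with
  | zero =>
    simp only [twoStageLaw, Mechanism.lawUpTo, integral_dirac, pow_zero, Module.End.one_apply]
    simp [score]
  | succ k ih =>
    rw [integral_twoStageLaw_succ_of_lt hL hε hε' hp₀ hp h hk, pow_succ, Module.End.mul_apply,
      ← ih (Nat.le_of_succ_le h) (Nat.le_of_succ_le hk)]
    congr 1
    ext z
    simp only [score_snoc_of_lt hk, apply_add_bitSign, expect_tilt_mul, walk_apply]
    ring

/-- Each report contributes the covariance `-θ η` between its two signs. Monotonicity makes the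
difference quotients of `f` and `g` nonnegative and survives averaging over a step, so after
multiplication by `θ η` every step adds a nonpositive term, whatever the signs of the drifts. -/
theorem covariance_score_le {k : ℕ} (h : k ≤ n) (hk : k ≤ m) {f g : ℝ → ℝ} (hf : Monotone f)
    (hg : Monotone g) {i j : Fin d} (hij : i ≠ j) :
    (ε * (p i - p₀ i)) * (ε * (p j - p₀ j)) *
      (∫ z, f (score m z i) * g (score m z j) ∂(twoStageLaw m hL hε hε' hp₀ p k h) -
        (walk (ε * (p i - p₀ i)) ^ k) f 0 * (walk (ε * (p j - p₀ j)) ^ k) g 0) ≤ 0 := by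
  induction k generalizing f g with
  | zero =>
    simp only [twoStageLaw, Mechanism.lawUpTo, integral_dirac, pow_zero, Module.End.one_apply]
    simp [score]
  | succ k ih =>
    have hk' := Nat.le_of_succ_le h
    have := Mechanism.isProbabilityMeasure_lawUpTo
      ((twoStageScheme d m hL).mechanism n hε hε' hp₀) hp k hk'
    set θ := ε * (p i - p₀ i) with hθ
    set η := ε * (p j - p₀ j) with hη
    have ih' := ih hk' (Nat.le_of_succ_le hk)
      (monotone_walk (abs_drift_le hε hε' hp₀ hp i) hf)
      (monotone_walk (abs_drift_le hε hε' hp₀ hp j) hg)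
    rw [integral_twoStageLaw_succ_of_lt hL hε hε' hp₀ hp h hk, pow_succ, pow_succ,
      Module.End.mul_apply, Module.End.mul_apply]
    refine le_trans ?_ ih'
    rw [mul_sub, mul_sub]
    refine sub_le_sub_right ?_ _
    rw [← integral_const_mul, ← integral_const_mul]
    refine integral_mono Integrable.of_finite Integrable.of_finite fun z => ?_
    simp only [score_snoc_of_lt hk, apply_add_bitSign, expect_tilt_mul_mul _ _ hij, ← hθ, ← hη,
      walk_apply]
    set s := score m z i
    set t := score m z j
    have h1 : f (s - 1) ≤ f (s + 1) := hf (by linarith)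
    have h2 : g (t - 1) ≤ g (t + 1) := hg (by linarith)
    have h3 : 0 ≤ (f (s + 1) - f (s - 1)) / 2 * ((g (t + 1) - g (t - 1)) / 2) * (θ * η) ^ 2 :=
      mul_nonneg (mul_nonneg (by linarith) (by linarith)) (sq_nonneg _)
    linarith

/-- Off-diagonal terms carry the weight `Δ_i Δ_j` and are nonpositive by `covariance_score_le`; only
the variances of the clipped scores remain. -/
theorem integral_signal_sub_sq_le (hε0 : 0 < ε) (h : m ≤ n) :
    ∫ z, (signal L (p - p₀) (score m z)
        - (∑ j, (p j - p₀ j) * ((walk (ε * (p j - p₀ j)) ^ m) (clip L) 0 / L))) ^ 2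
      ∂(twoStageLaw m hL hε hε' hp₀ p m h) ≤ m / L ^ 2 * ∑ j, (p j - p₀ j) ^ 2 := by
  have := Mechanism.isProbabilityMeasure_lawUpTo
    ((twoStageScheme d m hL).mechanism n hε hε' hp₀) hp m h
  set μ : Fin d → ℝ := fun j => (walk (ε * (p j - p₀ j)) ^ m) (clip L) 0 with hμ
  change ∫ z, (signal L (p - p₀) (score m z) - ∑ j, (p j - p₀ j) * (μ j / L)) ^ 2 ∂_ ≤ _
  have hmono : ∀ j, Monotone (fun s => clip L s - μ j) := fun j s t hst =>
    sub_le_sub_right (monotone_clip L hst) _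
  have hzero : ∀ j, (walk (ε * (p j - p₀ j)) ^ m) (fun s => clip L s - μ j) 0 = 0 := by
    intro j
    have e : (fun s => clip L s - μ j) = clip L - fun _ => μ j := rfl
    rw [e, map_sub, Pi.sub_apply, walk_pow_const, sub_self]
  have hexp : ∀ z : Fin m → Report d, (signal L (p - p₀) (score m z)
      - (∑ j, (p j - p₀ j) * (μ j / L))) ^ 2 = ∑ i, ∑ j, (p i - p₀ i) * (p j - p₀ j) / L ^ 2 *
        ((clip L (score m z i) - μ i) * (clip L (score m z j) - μ j)) := by
    intro z
    rw [signal, ← Finset.sum_sub_distrib, sq, Finset.sum_mul_sum]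
    refine Finset.sum_congr rfl fun i _ => Finset.sum_congr rfl fun j _ => ?_
    simp only [Pi.sub_apply]
    field_simp
  simp only [hexp]
  rw [integral_finsetSum _ fun i _ => Integrable.of_finite, Finset.mul_sum]
  refine Finset.sum_le_sum fun i _ => ?_
  rw [integral_finsetSum _ fun i _ => Integrable.of_finite]
  calc _ ≤ ∑ j, if i = j then m / L ^ 2 * (p i - p₀ i) ^ 2 else 0 := by
        refine Finset.sum_le_sum fun j _ => ?_
        rw [integral_const_mul]
        split_ifs with hij
        · subst hij
          have h1 := integral_score hL hε hε' hp₀ hp h le_rfl (fun s => (clip L s - μ i) ^ 2) i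
          have h2 := walk_pow_clip_variance (L := L) (abs_drift_le hε hε' hp₀ hp i) m
          rw [← hμ] at *
          simp only [← sq]
          rw [h1]
          calc _ ≤ (p i - p₀ i) ^ 2 / L ^ 2 * m := by gcongr
            _ = _ := by ring
        · have h1 := covariance_score_le hL hε hε' hp₀ hp h le_rfl (hmono i) (hmono j) hij
          rw [hzero i, zero_mul, sub_zero] at h1
          set I := ∫ z, (clip L (score m z i) - μ i) * (clip L (score m z j) - μ j)
            ∂(twoStageLaw m hL hε hε' hp₀ p m h)
          have h2 : (p i - p₀ i) * (p j - p₀ j) * I ≤ 0 := by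
            have h3 : 0 < ε ^ 2 := by positivity
            by_contra! h4
            nlinarith [mul_pos h3 h4]
          rw [div_mul_eq_mul_div]
          exact div_nonpos_of_nonpos_of_nonneg h2 (by positivity)
    _ = _ := by simp

theorem integral_comp_score {k : ℕ} (hk : m ≤ k) (h : k ≤ n) (G : (Fin d → ℝ) → ℝ) :
    ∫ z, G (score m z) ∂(twoStageLaw m hL hε hε' hp₀ p k h) =
      ∫ z, G (score m z) ∂(twoStageLaw m hL hε hε' hp₀ p m (hk.trans h)) := by
  induction k, hk using Nat.le_induction with
  | base => rfl
  | succ k hk ih =>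
    rw [integral_twoStageLaw_succ_of_le hL hε hε' hp₀ hp h hk, ← ih (Nat.le_of_succ_le h)]
    congr 1
    ext z
    simp only [score_snoc_of_le hk, ← Finset.expect_mul, Finset.expect_add_distrib,
      expect_bitSign_snd]
    simp

/-- The scores are frozen in the second stage, so the centered tally is a martingale whose
increments have conditional variance `1 - v ^ 2 ≤ 1`. -/
theorem integral_tally_sub_sq_le {k : ℕ} (hk : m ≤ k) (h : k ≤ n) :
    ∫ z, (tally m z - ((k : ℝ) - m) * (ε * signal L (p - p₀) (score m z))) ^ 2
      ∂(twoStageLaw m hL hε hε' hp₀ p k h) ≤ (k : ℝ) - m := by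
  induction k, hk using Nat.le_induction with
  | base => simp [tally_eq_zero]
  | succ k hk ih =>
    have := Mechanism.isProbabilityMeasure_lawUpTo
      ((twoStageScheme d m hL).mechanism n hε hε' hp₀) hp k (Nat.le_of_succ_le h)
    rw [integral_twoStageLaw_succ_of_le hL hε hε' hp₀ hp h hk]
    have key : ∀ z : Fin k → Report d, Finset.univ.expect (fun w : Report d =>
        (1 + bitSign w.2 * (ε * signal L (p - p₀) (score m z))) *
          (tally m (Fin.snoc z w : Fin (k + 1) → Report d) - (((k + 1 : ℕ) : ℝ) - m) *
            (ε * signal L (p - p₀) (score m (Fin.snoc z w : Fin (k + 1) → Report d)))) ^ 2) ≤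
        (tally m z - ((k : ℝ) - m) * (ε * signal L (p - p₀) (score m z))) ^ 2 + 1 := by
      intro z
      simp only [score_snoc_of_le hk, tally_snoc_of_le hk]
      set v := ε * signal L (p - p₀) (score m z)
      set A := tally m z - ((k : ℝ) - m) * v with hA
      have e : ∀ w : Report d, (1 + bitSign w.2 * v) *
          (tally m z + bitSign w.2 - (((k + 1 : ℕ) : ℝ) - m) * v) ^ 2 =
          (A ^ 2 + 1 - v ^ 2) + (v * (A ^ 2 + 1 + v ^ 2 - 2 * A * v) + 2 * (A - v)) *
            bitSign w.2 := by
        intro w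
        have hs := bitSign_mul_self w.2
        have e1 : tally m z + bitSign w.2 - (((k + 1 : ℕ) : ℝ) - m) * v
            = A - v + bitSign w.2 := by rw [hA]; push_cast; ring
        rw [e1]
        linear_combination (1 + 2 * v * (A - v) + v * bitSign w.2) * hs
      simp only [e, Finset.expect_add_distrib, ← Finset.mul_expect, expect_bitSign_snd]
      simp
      positivity
    calc _ ≤ ∫ z, ((tally m z - ((k : ℝ) - m) * (ε * signal L (p - p₀) (score m z))) ^ 2 + 1)
          ∂(twoStageLaw m hL hε hε' hp₀ p k (Nat.le_of_succ_le h)) :=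
          integral_mono Integrable.of_finite Integrable.of_finite key
      _ ≤ _ := by
        rw [integral_add Integrable.of_finite Integrable.of_finite]
        have := ih (Nat.le_of_succ_le h)
        simp only [integral_const, probReal_univ, one_smul]
        push_cast
        linarith

end Moments

/-! ### The test and its risk -/

/-! ### Numerical inequalities behind the two error bounds. -/

section Arithmetic

variable {M ε γ N S v t κ : ℝ} (hM : 0 < M) (hε : 0 < ε) (hγ : 0 < γ) (hN : 0 < N)
  (hN2 : N ^ 2 = S) (hv : N / 16 ≤ v) (hMS : 70000 ≤ M * (ε ^ 2 * S) * γ)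
include hM hε hγ hN hN2 hv hMS

theorem two_mul_threshold_le (ht2 : t ^ 2 = 4 * (M / γ)) :
    2 * t ≤ M * (ε * v) := by
  have h : M * (ε * N) / 16 ≤ M * (ε * v) := by
    rw [mul_div_assoc, mul_div_assoc]
    gcongr
  refine le_trans ((le_abs_self _).trans (abs_le_of_sq_le_sq ?_ (by positivity))) h
  have h1 : (M * (ε * N) / 16) ^ 2 = M * (M * (ε ^ 2 * S)) / 256 := by rw [← hN2]; ring
  have h2 : (2 * t) ^ 2 = 16 * M / γ := by rw [mul_pow, ht2]; ring
  rw [h1, h2, div_le_iff₀ hγ]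
  calc 16 * M ≤ M * 70000 / 256 := by linarith
    _ ≤ M * (M * (ε ^ 2 * S) * γ) / 256 := by gcongr
    _ = _ := by ring

theorem type_two_bound_le (hκ : κ ≤ γ / 8192) :
    (2 * M + 2 * (M * ε) ^ 2 * (κ * S)) / (M * (ε * v) / 2) ^ 2 ≤ γ / 2 := by
  have hS : 0 < S := hN2 ▸ by positivity
  have h : M * (ε * N) / 16 ≤ M * (ε * v) := by
    rw [mul_div_assoc, mul_div_assoc]
    gcongr
  have h1 : (M * (ε * N) / 16 / 2) ^ 2 = M * (M * (ε ^ 2 * S)) / 1024 := by rw [← hN2]; ring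
  have h2 : M * (M * (ε ^ 2 * S)) / 1024 ≤ (M * (ε * v) / 2) ^ 2 := by
    rw [← h1]
    gcongr
  rw [div_le_iff₀ (lt_of_lt_of_le (by positivity) h2)]
  calc 2 * M + 2 * (M * ε) ^ 2 * (κ * S)
      ≤ 2 * M + 2 * (M * ε) ^ 2 * (γ / 8192 * S) := by gcongr
    _ = 2 * M + M * (M * (ε ^ 2 * S) * γ) / 4096 := by ring
    _ ≤ M * (M * (ε ^ 2 * S) * γ) / 2048 := by
      have := mul_le_mul_of_nonneg_left hMS hM.le
      linarith
    _ = γ / 2 * (M * (M * (ε ^ 2 * S)) / 1024) := by ring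
    _ ≤ _ := by gcongr

end Arithmetic

/-! ### Error probabilities, separation and radii. -/

section Risk

variable {d n m : ℕ} {L ε : ℝ} {p₀ p : Fin d → ℝ}

/-- The signal of the second stage has the order of the Euclidean norm of the perturbation. -/
theorem le_expected_signal (hL : 2 ≤ L) (hε0 : 0 < ε) (hε' : ε ≤ 1 / 2)
    (hp₀ : p₀ ∈ stdSimplex ℝ (Fin d)) (hp : p ∈ stdSimplex ℝ (Fin d)) (hm : 64 * m ≤ L ^ 2)
    {N : ℝ} (hN : 0 < N) (hN2 : N ^ 2 = ∑ j, (p j - p₀ j) ^ 2) (hNL : L ≤ m * (ε * N)) :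
    N / 16 ≤ ∑ j, (p j - p₀ j) * ((walk (ε * (p j - p₀ j)) ^ m) (clip L) 0 / L) := by
  have hL0 : 0 < L := by linarith
  have hterm : ∀ j, (p j - p₀ j) ^ 2 / (16 * N) ≤
      (p j - p₀ j) * ((walk (ε * (p j - p₀ j)) ^ m) (clip L) 0 / L) := by
    intro j
    have h1 := le_mul_walk_pow_clip hL (abs_drift_le hε0.le hε' hp₀ hp j) hm
    set Δ := p j - p₀ j with hΔ
    set W := (walk (ε * Δ) ^ m) (clip L) 0
    have h2 : |Δ| ≤ N := by
      refine abs_le_of_sq_le_sq ?_ hN.le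
      rw [hN2]
      exact Finset.single_le_sum (f := fun j => (p j - p₀ j) ^ 2) (fun i _ => sq_nonneg _)
        (Finset.mem_univ j)
    -- This linear minorant of the minimum turns the sum over coordinates into `∑ Δ_j² / N`.
    have h3 : L * |Δ| / N ≤ min (m * |ε * Δ|) L := by
      rw [abs_mul, abs_of_pos hε0]
      refine le_min ?_ ?_
      · rw [div_le_iff₀ hN]
        calc L * |Δ| ≤ m * (ε * N) * |Δ| := by gcongr
          _ = _ := by ring
      · rw [div_le_iff₀ hN]
        gcongr
    have h4 : |ε * Δ| * (L * |Δ| / N) / 16 ≤ ε * Δ * W := le_trans (by gcongr) h1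
    rw [abs_mul, abs_of_pos hε0] at h4
    have h5 : ε * (Δ ^ 2 / (16 * N)) * L ≤ ε * (Δ * W) := by
      calc _ = ε * |Δ| * (L * |Δ| / N) / 16 := by rw [← sq_abs Δ]; field_simp
        _ ≤ _ := by linarith
    rw [mul_assoc, mul_le_mul_iff_right₀ hε0] at h5
    rw [← mul_div_assoc, le_div_iff₀ hL0]
    exact h5
  calc N / 16 = ∑ j, (p j - p₀ j) ^ 2 / (16 * N) := by
        rw [← Finset.sum_div, ← hN2]; field_simp
    _ ≤ _ := Finset.sum_le_sum fun j _ => hterm j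

/-- The test that rejects when the tally of the second stage is large. -/
def tallyTest (m : ℕ) (t : ℝ) (z : Fin n → Report d) : ℝ := if t ≤ tally m z then 1 else 0

theorem tallyTest_mem_Icc (t : ℝ) (z : Fin n → Report d) : tallyTest m t z ∈ Set.Icc (0 : ℝ) 1 := by
  unfold tallyTest
  split_ifs <;> simp

theorem integral_tallyTest_le (hL : 0 < L) (hε : 0 ≤ ε) (hε' : ε ≤ 1 / 2)
    (hp₀ : p₀ ∈ stdSimplex ℝ (Fin d)) (hm : m ≤ n) {t : ℝ} (ht : 0 < t) :
    ∫ z, tallyTest m t z ∂(twoStageLaw m hL hε hε' hp₀ p₀ n le_rfl) ≤ ((n : ℝ) - m) / t ^ 2 := by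
  have := Mechanism.isProbabilityMeasure_lawUpTo
    ((twoStageScheme d m hL).mechanism n hε hε' hp₀) hp₀ n le_rfl
  have h := integral_tally_sub_sq_le hL hε hε' hp₀ hp₀ hm le_rfl
  simp only [sub_self, signal, Pi.zero_apply, zero_mul, Finset.sum_const_zero, mul_zero,
    sub_zero] at h
  calc _ ≤ ∫ z, tally m z ^ 2 / t ^ 2 ∂(twoStageLaw m hL hε hε' hp₀ p₀ n le_rfl) := by
        refine integral_mono Integrable.of_finite Integrable.of_finite fun z => ?_
        beta_reduce
        unfold tallyTest
        split_ifs with hz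
        · rw [one_le_div (by positivity)]
          gcongr
        · positivity
    _ ≤ _ := by
      rw [integral_div]
      gcongr

/-- A missed rejection forces the tally at least half its mean below that mean. The deviation splits
into second-stage noise and the fluctuation of the learned signal, each bounded in mean square. -/
theorem integral_one_sub_tallyTest_le (hL : 0 < L) (hε0 : 0 < ε) (hε' : ε ≤ 1 / 2)
    (hp₀ : p₀ ∈ stdSimplex ℝ (Fin d)) (hp : p ∈ stdSimplex ℝ (Fin d)) (hm : m ≤ n) {t v : ℝ}
    (hv : v = ∑ j, (p j - p₀ j) * ((walk (ε * (p j - p₀ j)) ^ m) (clip L) 0 / L))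
    (ht : 0 < t) (htv : 2 * t ≤ ((n : ℝ) - m) * (ε * v)) :
    ∫ z, (1 - tallyTest m t z) ∂(twoStageLaw m hL hε0.le hε' hp₀ p n le_rfl) ≤
      (2 * ((n : ℝ) - m) + 2 * (((n : ℝ) - m) * ε) ^ 2 *
        (m / L ^ 2 * ∑ j, (p j - p₀ j) ^ 2)) / ((((n : ℝ) - m) * (ε * v)) / 2) ^ 2 := by
  have := Mechanism.isProbabilityMeasure_lawUpTo
    ((twoStageScheme d m hL).mechanism n hε0.le hε' hp₀) hp n le_rfl
  have h1 := integral_tally_sub_sq_le hL hε0.le hε' hp₀ hp hm le_rfl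
  have h2 := integral_signal_sub_sq_le hL hε0.le hε' hp₀ hp hε0 hm
  rw [← hv, ← integral_comp_score hL hε0.le hε' hp₀ hp hm le_rfl
    (fun s => (signal L (p - p₀) s - v) ^ 2)] at h2
  set M := (n : ℝ) - m with hM
  set μ := M * (ε * v) with hμ
  calc _ ≤ ∫ z, (2 * (tally m z - M * (ε * signal L (p - p₀) (score m z))) ^ 2 +
          2 * (M * ε) ^ 2 * (signal L (p - p₀) (score m z) - v) ^ 2) / (μ / 2) ^ 2
          ∂(twoStageLaw m hL hε0.le hε' hp₀ p n le_rfl) := by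
        refine integral_mono Integrable.of_finite Integrable.of_finite fun z => ?_
        beta_reduce
        unfold tallyTest
        split_ifs with hz
        · rw [sub_self]; positivity
        · rw [sub_zero, one_le_div (by have : 0 < μ := by linarith
                                       positivity)]
          set X := tally m z
          set V := signal L (p - p₀) (score m z)
          have h3 : (μ / 2) ^ 2 ≤ (μ - X) ^ 2 := by
            have : 0 < μ := by linarith
            have : μ / 2 ≤ μ - X := by linarith
            gcongr
          have h4 : (μ - X) ^ 2 ≤ 2 * (X - M * (ε * V)) ^ 2 + 2 * (M * ε) ^ 2 * (V - v) ^ 2 := by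
            rw [hμ]
            nlinarith [sq_nonneg (X - M * (ε * V) - M * ε * (V - v))]
          linarith
    _ ≤ _ := by
      rw [integral_div, integral_add Integrable.of_finite Integrable.of_finite,
        integral_const_mul, integral_const_mul]
      gcongr

theorem mechanismRisk_le_of_forall (Q : Mechanism d n) {δ γ : ℝ} {r : ℝ≥0∞}
    {φ : (Fin n → Q.Z) → ℝ} (hφ : Measurable φ) (hφ' : ∀ z, φ z ∈ Set.Icc (0 : ℝ) 1)
    (h : ∀ p ∈ alternative p₀ δ r, (∫ z, φ z ∂(Q.law p₀)) + ∫ z, (1 - φ z) ∂(Q.law p) ≤ γ) :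
    mechanismRisk p₀ δ Q r ≤ ENNReal.ofReal γ :=
  iInf_le_of_le φ <| iInf_le_of_le hφ <| iInf_le_of_le hφ' <|
    iSup₂_le fun p hp => ENNReal.ofReal_le_ofReal (h p hp)

theorem twoStage_error_le {t γ N : ℝ} (hL : 2 ≤ L) (hL0 : 0 < L) (hε0 : 0 < ε) (hε' : ε ≤ 1 / 2)
    (hp₀ : p₀ ∈ stdSimplex ℝ (Fin d)) (hp : p ∈ stdSimplex ℝ (Fin d)) (hmn : m ≤ n)
    (hm : 64 * m ≤ L ^ 2) (hM0 : 0 < (n : ℝ) - m) (hγ : 0 < γ) (hN0 : 0 < N)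
    (hN2 : N ^ 2 = ∑ j, (p j - p₀ j) ^ 2) (hNL : L ≤ m * (ε * N))
    (hMS : 70000 ≤ ((n : ℝ) - m) * (ε ^ 2 * ∑ j, (p j - p₀ j) ^ 2) * γ)
    (hmL : m / L ^ 2 ≤ γ / 8192) (ht0 : 0 < t) (ht2 : t ^ 2 = 4 * (((n : ℝ) - m) / γ)) :
    (∫ z, tallyTest m t z ∂(twoStageLaw m hL0 hε0.le hε' hp₀ p₀ n le_rfl)) +
      ∫ z, (1 - tallyTest m t z) ∂(twoStageLaw m hL0 hε0.le hε' hp₀ p n le_rfl) ≤ γ := by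
  obtain ⟨v, hv⟩ : ∃ v, v = ∑ j, (p j - p₀ j) *
    ((walk (ε * (p j - p₀ j)) ^ m) (clip L) 0 / L) := ⟨_, rfl⟩
  have hvN : N / 16 ≤ v := hv ▸ le_expected_signal hL hε0 hε' hp₀ hp hm hN0 hN2 hNL
  have hI := integral_tallyTest_le hL0 hε0.le hε' hp₀ hmn ht0
  have hI' : ((n : ℝ) - m) / t ^ 2 = γ / 4 := by
    rw [ht2]
    field_simp
  have hII := integral_one_sub_tallyTest_le hL0 hε0 hε' hp₀ hp hmn hv ht0
    (two_mul_threshold_le hM0 hε0 hγ hN0 hN2 hvN hMS ht2)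
  have hII' := type_two_bound_le hM0 hε0 hγ hN0 hN2 hvN hMS hmL
  linarith

/-- Separation in Euclidean norm from all alternatives makes them testable. -/
theorem minimaxRisk_le (hn : 1 ≤ n) {α γ : ℝ} (hα : 0 < α) (hα1 : α ≤ 1) (hγ : 0 < γ)
    (hγ1 : γ < 1) (hp₀ : p₀ ∈ stdSimplex ℝ (Fin d)) {δ : ℝ} {r : ℝ≥0∞}
    (hsep : ∀ p ∈ alternative p₀ δ r,
      3000 ^ 2 ≤ (n : ℝ) * α ^ 2 * γ ^ 2 * ∑ j, (p j - p₀ j) ^ 2) :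
    minimaxRisk n α p₀ δ r ≤ ENNReal.ofReal γ := by
  have hn0 : (1 : ℝ) ≤ n := by exact_mod_cast hn
  set m := n / 2 with hm
  have hmn : m ≤ n := Nat.div_le_self _ _
  have hM : (n : ℝ) / 2 ≤ (n : ℝ) - m := by
    have : ((2 * m : ℕ) : ℝ) ≤ n := by exact_mod_cast (by omega : 2 * m ≤ n)
    push_cast at this
    linarith
  have hM0 : 0 < (n : ℝ) - m := by linarith
  set ε := α / 8 with hε
  have hε0 : 0 < ε := by positivity
  have hε' : ε ≤ 1 / 2 := by linarith
  -- This scale makes the relative variance of the signal `m / L²` at most `γ / 8192`.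
  set L := Real.sqrt (8192 * n / γ) with hLdef
  have hL2 : L ^ 2 = 8192 * n / γ := Real.sq_sqrt (by positivity)
  have hL8192 : 8192 * (n : ℝ) ≤ L ^ 2 := by
    rw [hL2, le_div_iff₀ hγ]
    nlinarith
  have hL : 2 ≤ L := by
    refine (le_abs_self _).trans (abs_le_of_sq_le_sq ?_ (Real.sqrt_nonneg _))
    linarith
  have hL0 : 0 < L := by linarith
  -- Chebyshev's inequality with this threshold gives a type I error at most `γ / 4`.
  set t := 2 * Real.sqrt (((n : ℝ) - m) / γ) with ht
  have ht0 : 0 < t := by positivity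
  have ht2 : t ^ 2 = 4 * (((n : ℝ) - m) / γ) := by
    rw [ht, mul_pow, Real.sq_sqrt (by positivity)]; norm_num
  have hLDP : 1 + 2 * ε ≤ Real.exp α * (1 - 2 * ε) := by
    have := Real.add_one_le_exp α
    have h : (α + 1) * (1 - 2 * ε) ≤ Real.exp α * (1 - 2 * ε) := by
      gcongr
      linarith
    refine le_trans ?_ h
    rw [hε]
    nlinarith
  set Q := (twoStageScheme d m hL0).mechanism n hε0.le hε' hp₀ with hQ
  refine iInf₂_le_of_le Q ((twoStageScheme d m hL0).isLDP_mechanism n hε0.le hε' hp₀ hLDP) ?_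
  refine mechanismRisk_le_of_forall Q (φ := tallyTest m t) (measurable_of_finite _)
    (tallyTest_mem_Icc t) fun p hpalt => ?_
  clear_value t L
  have hp := hpalt.1
  have hS := hsep p hpalt
  obtain ⟨S, hSdef⟩ : ∃ S, S = ∑ j, (p j - p₀ j) ^ 2 := ⟨_, rfl⟩
  rw [← hSdef] at hS
  have hS0 : 0 ≤ S := hSdef ▸ Finset.sum_nonneg fun j _ => sq_nonneg _
  have hS2 : S ≤ 4 := by
    rw [hSdef]
    calc _ ≤ ∑ j, (p j + p₀ j) * 2 := Finset.sum_le_sum fun j _ => by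
          have h1 : p j ≤ 1 := hp.2 ▸ Finset.single_le_sum (fun i _ => hp.1 i) (Finset.mem_univ j)
          have h2 : p₀ j ≤ 1 :=
            hp₀.2 ▸ Finset.single_le_sum (fun i _ => hp₀.1 i) (Finset.mem_univ j)
          nlinarith [hp.1 j, hp₀.1 j, mul_nonneg (hp.1 j) (hp₀.1 j)]
      _ = 4 := by rw [← Finset.sum_mul, Finset.sum_add_distrib, hp.2, hp₀.2]; norm_num
  -- Since `ε² = α² / 64`, the constant comes from `3000² / 64 = 140625`.
  have hnS : 140000 ≤ n * (ε ^ 2 * S) * γ := by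
    have h1 : (n : ℝ) * α ^ 2 * γ ^ 2 * S ≤ n * α ^ 2 * γ * S := by
      have : γ ^ 2 ≤ γ := by nlinarith
      gcongr
    have h2 : (n : ℝ) * (ε ^ 2 * S) * γ = n * α ^ 2 * γ * S / 64 := by rw [hε]; ring
    rw [h2]
    linarith
  -- For `n = 1` the first stage would be empty, but then `S ≤ 4` contradicts the separation.
  have hn2 : 2 ≤ n := by
    by_contra! h
    have h1 : n = 1 := by omega
    rw [h1] at hnS
    have : ε ^ 2 ≤ 1 := by nlinarith
    have : ε ^ 2 * S ≤ 4 := by nlinarith [sq_nonneg ε]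
    norm_num at hnS
    nlinarith [mul_nonneg (sq_nonneg ε) hS0]
  have hm3 : (n : ℝ) / 3 ≤ m := by
    have : ((n : ℕ) : ℝ) ≤ ((3 * m : ℕ) : ℝ) := by exact_mod_cast (by omega : n ≤ 3 * m)
    push_cast at this
    linarith
  have hmn' : (m : ℝ) ≤ n := by exact_mod_cast hmn
  have hSpos : 0 < S := by
    refine lt_of_le_of_ne hS0 fun h => ?_
    rw [← h] at hnS
    norm_num at hnS
  obtain ⟨N, hN0, hN2⟩ : ∃ N, 0 < N ∧ N ^ 2 = S :=
    ⟨Real.sqrt S, Real.sqrt_pos.2 hSpos, Real.sq_sqrt hS0⟩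
  have hNL : L ≤ m * (ε * N) := by
    refine (le_abs_self _).trans (abs_le_of_sq_le_sq ?_ (by positivity))
    have h1 : (m * (ε * N)) ^ 2 = m ^ 2 * (ε ^ 2 * S) := by rw [← hN2]; ring
    rw [h1, hL2, div_le_iff₀ hγ]
    calc 8192 * (n : ℝ) ≤ n / 9 * 140000 := by linarith
      _ ≤ n / 9 * (n * (ε ^ 2 * S) * γ) := by gcongr
      _ = (n / 3) ^ 2 * (ε ^ 2 * S) * γ := by ring
      _ ≤ _ := by gcongr
  have hMS : 70000 ≤ ((n : ℝ) - m) * (ε ^ 2 * S) * γ := by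
    calc (70000 : ℝ) ≤ n / 2 * (ε ^ 2 * S) * γ := by linarith
      _ ≤ _ := by gcongr
  have hmL : m / L ^ 2 ≤ γ / 8192 := by
    rw [hL2, div_div_eq_mul_div, div_le_div_iff₀ (by positivity) (by norm_num)]
    linarith [mul_le_mul_of_nonneg_left hmn' hγ.le]
  subst hSdef
  exact twoStage_error_le hL hL0 hε0 hε' hp₀ hp hmn (by linarith) hM0 hγ hN0 hN2 hNL hMS hmL
    ht0 ht2

theorem testingRadius_le (hn : 1 ≤ n) {α γ : ℝ} (hα : 0 < α) (hα1 : α ≤ 1) (hγ : 0 < γ)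
    (hγ1 : γ < 1) (hp₀ : p₀ ∈ stdSimplex ℝ (Fin d)) {δ : ℝ} (hδ : 0 < δ) {r : ℝ≥0∞}
    (hsep : ∀ p ∈ alternative p₀ δ r,
      3000 ^ 2 ≤ (n : ℝ) * α ^ 2 * γ ^ 2 * ∑ j, (p j - p₀ j) ^ 2) :
    testingRadius n α γ p₀ r ≤ ENNReal.ofReal δ :=
  iInf_le_of_le δ <| iInf_le_of_le hδ <|
    iInf_le _ (minimaxRisk_le hn hα hα1 hγ hγ1 hp₀ hsep)

theorem testingRadius_two_le (hn : 1 ≤ n) {α γ : ℝ} (hα : 0 < α) (hα1 : α ≤ 1) (hγ : 0 < γ)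
    (hγ1 : γ < 1) (hp₀ : p₀ ∈ stdSimplex ℝ (Fin d)) :
    testingRadius n α γ p₀ 2 ≤ ENNReal.ofReal (6002 / Real.sqrt ((n : ℝ) * α ^ 2 * γ ^ 2)) := by
  have hn0 : (0 : ℝ) < n := by exact_mod_cast hn
  have hA : 0 < (n : ℝ) * α ^ 2 * γ ^ 2 := by positivity
  refine testingRadius_le hn hα hα1 hγ hγ1 hp₀ (by positivity) fun p hp => ?_
  have h := hp.2
  rw [EuclideanSpace.norm_eq, div_le_iff₀ (Real.sqrt_pos.2 hA),
    ← Real.sqrt_mul (Finset.sum_nonneg fun j _ => sq_nonneg _)] at h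
  have h2 := (Real.le_sqrt' (by norm_num)).1 h
  simp only [Real.norm_eq_abs, sq_abs, Pi.sub_apply] at h2
  linarith

theorem testingRadius_one_le (hn : 1 ≤ n) {α γ : ℝ} (hα : 0 < α) (hα1 : α ≤ 1) (hγ : 0 < γ)
    (hγ1 : γ < 1) (hp₀ : p₀ ∈ stdSimplex ℝ (Fin d)) {B : Finset (Fin d)} (hB : B.Nonempty) :
    testingRadius n α γ p₀ 1 ≤ ENNReal.ofReal (6002 * max
      (Real.sqrt (B.card : ℝ) / Real.sqrt ((n : ℝ) * α ^ 2 * γ ^ 2)) (∑ j ∈ Bᶜ, p₀ j)) := by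
  have hn0 : (0 : ℝ) < n := by exact_mod_cast hn
  have hA : 0 < (n : ℝ) * α ^ 2 * γ ^ 2 := by positivity
  have hcard : (0 : ℝ) < B.card := by exact_mod_cast hB.card_pos
  have hτ : 0 < Real.sqrt (B.card : ℝ) / Real.sqrt ((n : ℝ) * α ^ 2 * γ ^ 2) := by positivity
  set x := max (Real.sqrt (B.card : ℝ) / Real.sqrt ((n : ℝ) * α ^ 2 * γ ^ 2)) (∑ j ∈ Bᶜ, p₀ j)
    with hx
  have hx0 : 0 < x := lt_of_lt_of_le hτ (le_max_left _ _)
  refine testingRadius_le hn hα hα1 hγ hγ1 hp₀ (by positivity) fun p hp => ?_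
  have h := hp.2
  rw [PiLp.norm_eq_of_L1] at h
  simp only [Real.norm_eq_abs, Pi.sub_apply] at h
  rw [← Finset.sum_add_sum_compl B] at h
  have h1 : ∑ j ∈ Bᶜ, |p j - p₀ j| ≤ ∑ j ∈ Bᶜ, p j + ∑ j ∈ Bᶜ, p₀ j := by
    rw [← Finset.sum_add_distrib]
    refine Finset.sum_le_sum fun j _ => abs_le.2 ⟨?_, ?_⟩ <;> linarith [hp.1.1 j, hp₀.1 j]
  -- Both vectors have total mass one, so mass gained outside `B` is lost on `B`.
  have h2 : ∑ j ∈ Bᶜ, p j ≤ ∑ j ∈ Bᶜ, p₀ j + ∑ j ∈ B, |p j - p₀ j| := by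
    have e1 := Finset.sum_add_sum_compl B p
    have e2 := Finset.sum_add_sum_compl B p₀
    rw [hp.1.2] at e1
    rw [hp₀.2] at e2
    have : ∑ j ∈ B, (p₀ j - p j) ≤ ∑ j ∈ B, |p j - p₀ j| :=
      Finset.sum_le_sum fun j _ => by rw [abs_sub_comm]; exact le_abs_self _
    rw [Finset.sum_sub_distrib] at this
    linarith
  have h3 : ∑ j ∈ Bᶜ, p₀ j ≤ x := le_max_right _ _
  -- The distance is at most `2 ∑_B |Δ_j| + 2 x`, whence `6002 = 2 * 3000 + 2`.
  have h4 : 3000 * x ≤ ∑ j ∈ B, |p j - p₀ j| := by linarith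
  have h5 : 3000 * (Real.sqrt (B.card : ℝ) / Real.sqrt ((n : ℝ) * α ^ 2 * γ ^ 2)) ≤
      ∑ j ∈ B, |p j - p₀ j| := le_trans (by gcongr; exact le_max_left _ _) h4
  have h6 := sq_sum_le_card_mul_sum_sq (s := B) (f := fun j => |p j - p₀ j|)
  simp only [sq_abs] at h6
  have h7 : ∑ j ∈ B, (p j - p₀ j) ^ 2 ≤ ∑ j, (p j - p₀ j) ^ 2 :=
    Finset.sum_le_univ_sum_of_nonneg fun j => sq_nonneg _
  have h8 : (3000 * (Real.sqrt (B.card : ℝ) / Real.sqrt ((n : ℝ) * α ^ 2 * γ ^ 2))) ^ 2 ≤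
      B.card * ∑ j, (p j - p₀ j) ^ 2 :=
    (pow_le_pow_left₀ (by positivity) h5 2).trans (h6.trans (by gcongr))
  rw [mul_pow, div_pow, Real.sq_sqrt hcard.le, Real.sq_sqrt hA.le, ← mul_div_assoc,
    div_le_iff₀ hA] at h8
  refine le_of_mul_le_mul_right ?_ hcard
  linarith

theorem testingRadius_one_le_jTilde (hn : 1 ≤ n) {α γ : ℝ} (hα : 0 < α) (hα1 : α ≤ 1)
    (hγ : 0 < γ) (hγ1 : γ < 1) (hp₀ : p₀ ∈ stdSimplex ℝ (Fin d)) :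
    testingRadius n α γ p₀ 1 ≤ ENNReal.ofReal (6002 / γ *
      (Real.sqrt (jTilde n α p₀ : ℝ) / Real.sqrt ((n : ℝ) * α ^ 2))) := by
  have hd : 1 ≤ d := by
    rcases Nat.eq_zero_or_pos d with rfl | h
    · simpa using hp₀.2
    · exact h
  obtain ⟨hj1, hjd, hj⟩ := (isLeast_jTilde hd n α p₀).1
  set k := jTilde n α p₀
  -- The first `k` letters: the tail mass is then bounded by the defining property of `jTilde`.
  set B : Finset (Fin d) := Finset.univ.filter fun x => (x : ℕ) < k with hB
  have hcard : B.card = k := by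
    rw [hB, Fin.card_filter_val_lt, min_eq_right hjd]
  have hBc : Bᶜ = Finset.univ.filter fun x : Fin d => k ≤ (x : ℕ) := by
    ext x; simp [hB]
  have hBne : B.Nonempty := Finset.card_pos.1 (by omega)
  refine (testingRadius_one_le hn hα hα1 hγ hγ1 hp₀ hBne).trans (ENNReal.ofReal_le_ofReal ?_)
  rw [hcard, hBc, Real.sqrt_mul (by positivity), Real.sqrt_sq hγ.le, ← div_div]
  set y := Real.sqrt (k : ℝ) / Real.sqrt ((n : ℝ) * α ^ 2)
  have hy : 0 ≤ y := by positivity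
  have hyγ : y ≤ y / γ := le_div_self hy hγ hγ1.le
  rw [div_mul_eq_mul_div, mul_div_assoc]
  gcongr
  exact max_le le_rfl (hj.trans hyγ)

end Risk

end LDPTesting

end

theorem theorem2 :
    (∃ C : ℝ, 0 < C ∧
      ∀ (d n : ℕ) (α γ : ℝ) (p₀ : Fin d → ℝ),
        1 ≤ n → 0 < α → α ≤ 1 → 0 < γ → γ < 1 → p₀ ∈ stdSimplex ℝ (Fin d) →
        (∀ B : Finset (Fin d), B.Nonempty →
          LDPTesting.testingRadius n α γ p₀ 1 ≤
            ENNReal.ofReal (C * max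
              (Real.sqrt (B.card : ℝ) / Real.sqrt ((n : ℝ) * α ^ 2 * γ ^ 2))
              (∑ j ∈ Bᶜ, p₀ j))) ∧
        LDPTesting.testingRadius n α γ p₀ 2 ≤
          ENNReal.ofReal (C / Real.sqrt ((n : ℝ) * α ^ 2 * γ ^ 2))) ∧
    (∀ γ : ℝ, 0 < γ → γ < 1 → ∃ C₁ : ℝ, 0 < C₁ ∧
      ∀ (d n : ℕ) (α : ℝ) (p₀ : Fin d → ℝ),
        1 ≤ n → 0 < α → α ≤ 1 → p₀ ∈ stdSimplex ℝ (Fin d) →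
        LDPTesting.testingRadius n α γ p₀ 1 ≤
          ENNReal.ofReal (C₁ *
            (Real.sqrt (LDPTesting.jTilde n α p₀ : ℝ) / Real.sqrt ((n : ℝ) * α ^ 2)))) := by
  refine ⟨⟨6002, by norm_num, fun d n α γ p₀ hn hα hα1 hγ hγ1 hp₀ => ⟨fun B hB => ?_, ?_⟩⟩,
    fun γ hγ hγ1 => ⟨6002 / γ, by positivity, fun d n α p₀ hn hα hα1 hp₀ => ?_⟩⟩
  · exact LDPTesting.testingRadius_one_le hn hα hα1 hγ hγ1 hp₀ hB
  · exact LDPTesting.testingRadius_two_le hn hα hα1 hγ hγ1 hp₀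
  · exact LDPTesting.testingRadius_one_le_jTilde hn hα hα1 hγ hγ1 hp₀
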